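/- Let $S\subset\mathbb R^n_+=[0,\infty)^n$ be compact and convex with $0\in S$. For $m\in\mathbb N$ let $\mathcal P^S_m(\mathbb C^n)$ be the set of polynomials $p(z)=\sum_{\alpha\in (mS)\cap\mathbb N^n}a_\alpha z^\alpha$, and let $\mathcal P^S(\mathbb C^n)=\bigcup_{m\in\mathbb N}\mathcal P^S_m(\mathbb C^n)$. For $K\subset\mathbb C^n$ put $\|p\|_K=\sup_{w\in K}|p(w)|\in[0,\infty]$; the $S$-hull of $K$ is $$\widehat K^S=\{z\in\mathbb C^n : |p(z)|\le \|p\|_K\text{ for all }p\in\mathcal P^S(\mathbb C^n)\}.$$ Write $\mathbb C^{*n}=(\mathbb C\setminus\{0\})^n$. Assume that $S$ has empty interior in $\mathbb R^n$. (1) Assume in addition that $\overline{S\cap\mathbb Q^n}=S$, and let $\ell=\dim\operatorname{span}_{\mathbb R}S$. Then $\ell<n$. There is a linear map $L\colon\mathbb R^\ell\to\mathbb R^n$ such that (a) $S\subset L(\mathbb R^\ell)$ and $L(\mathbb Z^\ell)=(\operatorname{span}_{\mathbb R}S)\cap\mathbb Z^n$, and $L$ can moreover be chosen with $L^{-1}(S)\subset\mathbb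 R^\ell_+$. There are also (b) vectors $\beta'_1,\dots,\beta'_{n-\ell}\in\mathbb Z^n$ that generate the lattice $\{\beta\in\mathbb Z^n:\langle\beta,s\rangle=0\text{ for all }s\in S\}$. For any $L$ as in (a) and any $\beta'_1,\dots,\beta'_{n-\ell}$ as in (b), define $F_L\colon\mathbb C^{*n}\to\mathbb C^{*\ell}$ by $F_L(z)=(z^{L(e_1)},\dots,z^{L(e_\ell)})$, put $\beta_j=(\beta'_{1j},\dots,\beta'_{n-\ell,j})\in\mathbb Z^{n-\ell}$ for $j=1,\dots,n$, and for $z\in\mathbb C^{*n}$ define $\Upsilon_z\colon\mathbb C^{*(n-\ell)}\to\mathbb C^{*n}$ by $\Upsilon_z(t)=(z_1t^{\beta_1},\dots,z_nt^{\beta_n})$. Then for every $z\in\mathbb C^{*n}$ $$\widehat{\{z\}}{}^S\cap\mathbb C^{*n}=F_L^{-1}(F_L(z))=\Upsilon_z[\mathbb C^{*(n-\ell)}].$$ (2) For every $K\subset\mathbb C^n$ that intersects $\mathbb C^{*n}$, the $S$-hull $\widehat K^S$ is unbounded. -/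

import Mathlib

open scoped Pointwise ENNReal

noncomputable section

namespace SHull

/-- The lattice `ℤⁿ` as a subset of `ℝⁿ`. -/
def integerPoints (n : ℕ) : Set (Fin n → ℝ) :=
  {x | ∀ j, ∃ a : ℤ, x j = (a : ℝ)}

/-- `ℚⁿ` as a subset of `ℝⁿ`. -/
def rationalPoints (n : ℕ) : Set (Fin n → ℝ) :=
  {x | ∀ j, ∃ q : ℚ, x j = (q : ℝ)}

/-- The closed orthant `ℝⁿ₊`, that is `(ℝ₊)ⁿ`. -/
def orthant (n : ℕ) : Set (Fin n → ℝ) :=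
  {x | ∀ j, 0 ≤ x j}

/-- The torus `(ℂ*)ⁿ` as a subset of `ℂⁿ`. -/
def torus (n : ℕ) : Set (Fin n → ℂ) :=
  {z | ∀ j, z j ≠ 0}

variable {n : ℕ}

/-- The space `𝒫ₘˢ(ℂⁿ)` of all polynomials whose exponents lie in `(mS) ∩ ℕⁿ`. -/
def polySpace (S : Set (Fin n → ℝ)) (m : ℕ) : Set (MvPolynomial (Fin n) ℂ) :=
  {p | ∀ α ∈ p.support, (fun j => (α j : ℝ)) ∈ (m : ℝ) • S}

/-- `𝒫ˢ(ℂⁿ)`, the union of the spaces `𝒫ₘˢ(ℂⁿ)` over `m ∈ ℕ`. -/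
def polyRing (S : Set (Fin n → ℝ)) : Set (MvPolynomial (Fin n) ℂ) :=
  ⋃ m : ℕ, polySpace S m

/-- The supremum `‖p‖_K` of `|p|` over `K`, with value `∞` if `p` is unbounded on `K`. -/
def supNorm (K : Set (Fin n → ℂ)) (p : MvPolynomial (Fin n) ℂ) : ℝ≥0∞ :=
  ⨆ w ∈ K, ‖MvPolynomial.eval w p‖ₑ

/-- The `S`-hull of `K`: all `z ∈ ℂⁿ` with `|p(z)| ≤ ‖p‖_K` for every `p ∈ 𝒫ˢ(ℂⁿ)`. -/
def hull (S : Set (Fin n → ℝ)) (K : Set (Fin n → ℂ)) : Set (Fin n → ℂ) :=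
  {z | ∀ p ∈ polyRing S, ‖MvPolynomial.eval z p‖ₑ ≤ supNorm K p}

/-- `L : ℝ^ℓ → ℝⁿ` is a linear map whose image contains `S`, where `ℓ` is the dimension of `S`
(of its linear span, as `0 ∈ S`), and which maps `ℤ^ℓ` onto the lattice points of `span S`. -/
structure IsLatticeParam (S : Set (Fin n → ℝ)) {ℓ : ℕ}
    (L : (Fin ℓ → ℝ) →ₗ[ℝ] (Fin n → ℝ)) : Prop where
  dim_eq : ℓ = Module.finrank ℝ (Submodule.span ℝ S)
  subset_range : S ⊆ Set.range L
  map_lattice : L '' integerPoints ℓ = (Submodule.span ℝ S : Set (Fin n → ℝ)) ∩ integerPoints n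

/-- The Laurent monomial `z^α = z₁^α₁ ⋯ zₙ^αₙ` with integer exponents. -/
def laurentMonomial (z : Fin n → ℂ) (α : Fin n → ℤ) : ℂ :=
  ∏ j, z j ^ α j

/-- `F_L(z) = (z^{L(e₁)}, …, z^{L(e_ℓ)})`. It is used for `L` mapping `ℤ^ℓ` into `ℤⁿ` only; then
the coordinates of `L(e_k)` are integers and the floor just reads them as such. -/
def monomialMap {ℓ : ℕ} (L : (Fin ℓ → ℝ) →ₗ[ℝ] (Fin n → ℝ)) (z : Fin n → ℂ) : Fin ℓ → ℂ :=
  fun k => laurentMonomial z (fun j => ⌊L (Pi.single k 1) j⌋)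

/-- The fiber in `(ℂ*)ⁿ` of `F_L : (ℂ*)ⁿ → (ℂ*)^ℓ` over `F_L(z)`. -/
def monomialFiber {ℓ : ℕ} (L : (Fin ℓ → ℝ) →ₗ[ℝ] (Fin n → ℝ)) (z : Fin n → ℂ) :
    Set (Fin n → ℂ) :=
  {w | w ∈ torus n ∧ monomialMap L w = monomialMap L z}

/-- The lattice of integer vectors that are orthogonal to `S`, or what is the same, to `span S`. -/
def orthogonalLattice (S : Set (Fin n → ℝ)) : Submodule ℤ (Fin n → ℤ) where
  carrier := {b | ∀ s ∈ S, ∑ j, (b j : ℝ) * s j = 0}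
  zero_mem' := by
    intro s _
    simp
  add_mem' := by
    intro a b ha hb s hs
    simp only [Pi.add_apply, Int.cast_add, add_mul, Finset.sum_add_distrib]
    rw [ha s hs, hb s hs, add_zero]
  smul_mem' := by
    intro c b hb s hs
    simp only [Pi.smul_apply, smul_eq_mul, Int.cast_mul, mul_assoc]
    rw [← Finset.mul_sum, hb s hs, mul_zero]

/-- `Υ_z(t) = (z₁ t^{β₁}, …, zₙ t^{βₙ})` where `β₁, …, βₙ` are the vectors dual to the family
`b = (β'₁, …, β'_d)` of vectors in `ℤⁿ`, that is `(β_j)_k = (β'_k)_j`. -/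
def fiberParam {d : ℕ} (b : Fin d → Fin n → ℤ) (z : Fin n → ℂ) (t : Fin d → ℂ) : Fin n → ℂ :=
  fun j => z j * laurentMonomial t (fun k => b k j)

end SHull

end

/-!
Write `Λ = span S ∩ ℤⁿ`. A monomial `z^α` with `α ∈ mS` is constant on the hull of a point `z` of
the torus, because `w^α - z^α` is a polynomial in `w` from `𝒫ₘˢ` that vanishes at `z`. As `S` is
convex and contains `0`, its dilates exhaust the cone over `S`, and every element of `Λ` is a
difference of integer points of that cone when `span S` is spanned by rational points of `S`. So a
point `w` of the torus lies in the hull of `z` exactly when the characters `a ↦ w^a` and `a ↦ z^a`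
of `ℤⁿ` agree on `Λ`.

The fibers of `F_L` satisfy the same condition since `L` carries `ℤ^ℓ` onto `Λ`. For the
parametrization `Υ_z`, let `B : ℤⁿ → ℤ^(n-ℓ)` have rows `β'_k`. Its kernel is `Λ`, because `ℤⁿ / Λ`
is free, and `w = Υ_z(t)` says that the character of `t` composed with `B` is the quotient of those
of `w` and `z`. Since `ℂ*` is divisible, every character trivial on `Λ` factors through `B`.

For `L⁻¹(S) ⊆ ℝ^ℓ₊` the sum of the coordinates, restricted to `Λ`, is a positive multiple of a
coordinate of some lattice basis; subtracting a large multiple of the other basis vectors from the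
first one makes all coordinates nonnegative on `span S ∩ ℝⁿ₊`. For unboundedness, the hull of `z`
contains the curve `τ ↦ (z_j exp(τ ξ_j))_j` for any `ξ ⟂ S`.
-/

namespace SHull

variable {n ℓ : ℕ}

/-- The inclusion `ℤⁿ → ℝⁿ`. -/
def castVec (n : ℕ) : (Fin n → ℤ) →ₗ[ℤ] (Fin n → ℝ) :=
  (Algebra.linearMap ℤ ℝ).compLeft (Fin n)

@[simp]
theorem castVec_apply (a : Fin n → ℤ) (j : Fin n) : castVec n a j = a j := rfl

theorem castVec_injective : Function.Injective (castVec n) := fun a b h =>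
  funext fun j => by simpa using congrFun h j

theorem range_castVec : Set.range (castVec n) = integerPoints n := by
  ext x
  constructor
  · rintro ⟨a, rfl⟩ j
    exact ⟨a j, rfl⟩
  · intro hx
    choose a ha using hx
    exact ⟨a, funext fun j => (ha j).symm⟩

theorem castVec_dotProduct_castVec (a b : Fin n → ℤ) :
    castVec n a ⬝ᵥ castVec n b = (a ⬝ᵥ b : ℤ) := by
  simp [dotProduct]

theorem exists_nat_smul_eq_castVec {x : Fin n → ℝ} (hx : x ∈ rationalPoints n) :
    ∃ D : ℕ, 0 < D ∧ ∃ a, (D : ℝ) • x = castVec n a := by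
  choose q hq using hx
  obtain ⟨⟨D, hD⟩, hint⟩ :=
    IsLocalization.exist_integer_multiples_of_finite (nonZeroDivisors ℤ) q
  choose a ha using hint
  refine ⟨D.natAbs, by simpa using nonZeroDivisors.ne_zero hD, D.sign • a, funext fun j => ?_⟩
  have haj : (a j : ℝ) = D * x j := by
    rw [hq]
    have := ha j
    simp only [eq_intCast, zsmul_eq_mul] at this
    exact_mod_cast this
  simp only [Pi.smul_apply, smul_eq_mul, castVec_apply, Int.cast_mul, haj, Nat.cast_natAbs]
  rw [← mul_assoc, ← Int.cast_mul, Int.sign_mul_self_eq_abs]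

theorem dotProduct_eq_zero_of_mem_span {T : Set (Fin n → ℝ)} {ξ x : Fin n → ℝ}
    (h : ∀ s ∈ T, ξ ⬝ᵥ s = 0) (hx : x ∈ Submodule.span ℝ T) : ξ ⬝ᵥ x = 0 :=
  Submodule.span_le (p := LinearMap.ker (dotProductEquiv ℝ (Fin n) ξ)).mpr h hx

theorem span_eq_of_subset_closure {E : Type*} [AddCommGroup E] [TopologicalSpace E]
    [IsTopologicalAddGroup E] [Module ℝ E] [ContinuousSMul ℝ E] [T2Space E]
    [FiniteDimensional ℝ E] {T S : Set E}
    (hTS : T ⊆ S) (hST : S ⊆ closure T) : Submodule.span ℝ T = Submodule.span ℝ S :=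
  le_antisymm (Submodule.span_mono hTS) <| Submodule.span_le.mpr <| hST.trans <|
    closure_minimal Submodule.subset_span (Submodule.closed_of_finiteDimensional _)

theorem span_range_coe_basis {κ R M : Type*} [Ring R] [AddCommGroup M] [Module R M]
    {N : Submodule R M} (B : Module.Basis κ R N) :
    Submodule.span R (Set.range fun k => (B k : M)) = N := by
  have := congrArg (Submodule.map N.subtype) B.span_eq
  rwa [Submodule.map_span, ← Set.range_comp, Submodule.map_subtype_top] at this

/-! ### Lattice points of rational subspaces -/

/-- The lattice `V ∩ ℤⁿ` of integer points of a subspace `V ⊆ ℝⁿ`, as a sublattice of `ℤⁿ`. -/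
def latticePoints (V : Submodule ℝ (Fin n → ℝ)) : Submodule ℤ (Fin n → ℤ) :=
  (V.restrictScalars ℤ).comap (castVec n)

theorem mem_latticePoints {V : Submodule ℝ (Fin n → ℝ)} {a : Fin n → ℤ} :
    a ∈ latticePoints V ↔ castVec n a ∈ V := Iff.rfl

theorem image_castVec_latticePoints (V : Submodule ℝ (Fin n → ℝ)) :
    castVec n '' latticePoints V = (V : Set (Fin n → ℝ)) ∩ integerPoints n := by
  rw [← range_castVec]
  exact Set.image_preimage_eq_inter_range

instance isTorsionFree_quotient_latticePoints (V : Submodule ℝ (Fin n → ℝ)) :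
    Module.IsTorsionFree ℤ ((Fin n → ℤ) ⧸ latticePoints V) := by
  refine .of_smul_eq_zero fun c a hca => or_iff_not_imp_left.mpr fun hc => ?_
  induction a using Submodule.Quotient.induction_on with | H a => ?_
  rw [← Submodule.Quotient.mk_smul, Submodule.Quotient.mk_eq_zero, mem_latticePoints, map_smul,
    ← Int.cast_smul_eq_zsmul ℝ] at hca
  rw [Submodule.Quotient.mk_eq_zero]
  exact (V.smul_mem_iff (Int.cast_ne_zero.mpr hc)).mp hca

instance free_quotient_latticePoints (V : Submodule ℝ (Fin n → ℝ)) :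
    Module.Free ℤ ((Fin n → ℤ) ⧸ latticePoints V) :=
  Module.free_of_finite_type_torsion_free'

/-- A rational subspace of `ℝⁿ`: one that is spanned by integer vectors. -/
def IsRational (V : Submodule ℝ (Fin n → ℝ)) : Prop :=
  Submodule.span ℝ (castVec n '' latticePoints V) = V

theorem isRational_span {T : Set (Fin n → ℝ)} (hT : T ⊆ rationalPoints n) :
    IsRational (Submodule.span ℝ T) := by
  refine le_antisymm (Submodule.span_le.mpr ?_) (Submodule.span_le.mpr fun x hx => ?_)
  · rintro _ ⟨a, ha, rfl⟩
    exact ha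
  · obtain ⟨D, hD, a, hDx⟩ := exists_nat_smul_eq_castVec (hT hx)
    have ha : a ∈ latticePoints (Submodule.span ℝ T) := by
      rw [mem_latticePoints, ← hDx]
      exact Submodule.smul_mem _ _ (Submodule.subset_span hx)
    have hcast := Submodule.subset_span (R := ℝ) (Set.mem_image_of_mem (castVec n) ha)
    rw [← hDx] at hcast
    exact (Submodule.smul_mem_iff _ (by positivity)).mp hcast

theorem linearIndependent_castVec_basis {V : Submodule ℝ (Fin n → ℝ)} {κ : Type*}
    (B : Module.Basis κ ℤ (latticePoints V)) : LinearIndependent ℝ fun k => castVec n (B k) :=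
  (linearIndependent_algebraMap_comp_iff (R := ℤ) (S := ℝ)).mpr <|
    B.linearIndependent.map' (latticePoints V).subtype (Submodule.ker_subtype _)

theorem IsRational.span_range_castVec_basis {V : Submodule ℝ (Fin n → ℝ)} (hV : IsRational V)
    {κ : Type*} (B : Module.Basis κ ℤ (latticePoints V)) :
    Submodule.span ℝ (Set.range fun k => castVec n (B k)) = V := by
  calc Submodule.span ℝ (Set.range fun k => castVec n (B k))
      = Submodule.span ℝ
          (castVec n '' Submodule.span ℤ (Set.range fun k => (B k : Fin n → ℤ))) := by
        rw [← Submodule.map_coe, Submodule.map_span, Submodule.span_span_of_tower, ← Set.range_comp]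
        rfl
    _ = V := by rw [span_range_coe_basis, hV]

theorem IsRational.finrank_latticePoints {V : Submodule ℝ (Fin n → ℝ)} (hV : IsRational V) :
    Module.finrank ℤ (latticePoints V) = Module.finrank ℝ V := by
  let B := Module.finBasis ℤ (latticePoints V)
  have hcard := finrank_span_eq_card (linearIndependent_castVec_basis B)
  rw [hV.span_range_castVec_basis B, Fintype.card_fin] at hcard
  exact hcard.symm

theorem mem_orthogonalLattice_iff {S : Set (Fin n → ℝ)}
    (hS : IsRational (Submodule.span ℝ S)) {b : Fin n → ℤ} :
    b ∈ orthogonalLattice S ↔ ∀ a ∈ latticePoints (Submodule.span ℝ S), b ⬝ᵥ a = 0 := by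
  have hcast (a : Fin n → ℤ) : b ⬝ᵥ a = 0 ↔ castVec n b ⬝ᵥ castVec n a = 0 := by
    rw [castVec_dotProduct_castVec, Int.cast_eq_zero]
  constructor
  · exact fun hb a ha => (hcast a).mpr (dotProduct_eq_zero_of_mem_span hb ha)
  · intro hb s hs
    have hs' := Submodule.subset_span (R := ℝ) hs
    rw [← hS] at hs'
    refine dotProduct_eq_zero_of_mem_span ?_ hs'
    rintro _ ⟨a, ha, rfl⟩
    exact (hcast a).mp (hb a ha)

theorem dualAnnihilator_dualCoannihilator_eq {R M : Type*} [CommRing R] [AddCommGroup M]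
    [Module R M] (W : Submodule R M) [Module.Projective R (M ⧸ W)] :
    W.dualAnnihilator.dualCoannihilator = W := by
  refine le_antisymm (fun x hx => ?_) W.le_dualAnnihilator_dualCoannihilator
  rw [← Submodule.Quotient.mk_eq_zero W, ← Module.forall_dual_apply_eq_zero_iff R]
  intro f
  exact (Submodule.mem_dualCoannihilator x).mp hx _ (W.dualQuotEquivDualAnnihilator f).2

theorem map_dotProductEquiv_orthogonalLattice {S : Set (Fin n → ℝ)}
    (hS : IsRational (Submodule.span ℝ S)) :
    (orthogonalLattice S).map (dotProductEquiv ℤ (Fin n) : (Fin n → ℤ) →ₗ[ℤ] _) =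
      (latticePoints (Submodule.span ℝ S)).dualAnnihilator := by
  ext f
  obtain ⟨b, rfl⟩ := (dotProductEquiv ℤ (Fin n)).surjective f
  rw [Submodule.mem_dualAnnihilator]
  exact (Submodule.mem_map_equiv _).trans (by simpa using mem_orthogonalLattice_iff hS)

theorem finrank_orthogonalLattice {S : Set (Fin n → ℝ)}
    (hS : IsRational (Submodule.span ℝ S)) :
    Module.finrank ℤ (orthogonalLattice S) = n - Module.finrank ℝ (Submodule.span ℝ S) := by
  let Λ := latticePoints (Submodule.span ℝ S)
  have hdual : Module.finrank ℤ (orthogonalLattice S) = Module.finrank ℤ ((Fin n → ℤ) ⧸ Λ) := by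
    rw [← LinearEquiv.finrank_map_eq (dotProductEquiv ℤ (Fin n)),
      map_dotProductEquiv_orthogonalLattice hS, ← Λ.dualQuotEquivDualAnnihilator.finrank_eq,
      ← (Module.finBasis ℤ ((Fin n → ℤ) ⧸ Λ)).toDualEquiv.finrank_eq]
  have hsum := Λ.finrank_quotient_add_finrank
  rw [hS.finrank_latticePoints, Module.finrank_fin_fun] at hsum
  exact hdual.trans (Nat.eq_sub_of_add_eq hsum)

theorem exists_span_range_eq_orthogonalLattice {S : Set (Fin n → ℝ)}
    (hS : IsRational (Submodule.span ℝ S)) :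
    ∃ b : Fin (n - Module.finrank ℝ (Submodule.span ℝ S)) → Fin n → ℤ,
      Submodule.span ℤ (Set.range b) = orthogonalLattice S :=
  ⟨_, span_range_coe_basis (Module.finBasisOfFinrankEq ℤ _ (finrank_orthogonalLattice hS))⟩

theorem ker_mulVecLin_of_span_eq_orthogonalLattice {S : Set (Fin n → ℝ)}
    (hS : IsRational (Submodule.span ℝ S)) {κ : Type*} {b : κ → Fin n → ℤ}
    (hb : Submodule.span ℤ (Set.range b) = orthogonalLattice S) :
    LinearMap.ker (Matrix.mulVecLin (Matrix.of b)) = latticePoints (Submodule.span ℝ S) := by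
  ext a
  have hspan : (∀ k, b k ⬝ᵥ a = 0) ↔ ∀ c ∈ orthogonalLattice S, c ⬝ᵥ a = 0 := by
    rw [← hb]
    simp only [dotProduct_comm _ a]
    exact Set.forall_mem_range.symm.trans (Submodule.span_le
      (p := LinearMap.ker (dotProductEquiv ℤ (Fin n) a))).symm
  rw [LinearMap.mem_ker, funext_iff, ← dualAnnihilator_dualCoannihilator_eq (latticePoints _),
    Submodule.mem_dualCoannihilator, ← map_dotProductEquiv_orthogonalLattice hS]
  exact hspan.trans (Set.forall_mem_image (f := dotProductEquiv ℤ (Fin n))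
    (p := fun f => f a = 0)).symm

/-! ### Lattice parametrizations -/

/-- The linear map `ℝ^ℓ → ℝⁿ` sending `e_k` to the integer vector `a_k`. -/
def latticeMap (a : Fin ℓ → Fin n → ℤ) : (Fin ℓ → ℝ) →ₗ[ℝ] (Fin n → ℝ) :=
  Fintype.linearCombination ℝ fun k => castVec n (a k)

theorem latticeMap_apply (a : Fin ℓ → Fin n → ℤ) (x : Fin ℓ → ℝ) :
    latticeMap a x = ∑ k, x k • castVec n (a k) :=
  Fintype.linearCombination_apply ..

@[simp]
theorem latticeMap_single (a : Fin ℓ → Fin n → ℤ) (k : Fin ℓ) :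
    latticeMap a (Pi.single k 1) = castVec n (a k) := by
  simp [latticeMap, Fintype.linearCombination_apply_single]

theorem latticeMap_castVec (a : Fin ℓ → Fin n → ℤ) (x : Fin ℓ → ℤ) :
    latticeMap a (castVec ℓ x) = castVec n (Fintype.linearCombination ℤ a x) := by
  simp only [latticeMap_apply, Fintype.linearCombination_apply, map_sum, map_smul, castVec_apply,
    Int.cast_smul_eq_zsmul]

theorem image_latticeMap_integerPoints (a : Fin ℓ → Fin n → ℤ) :
    latticeMap a '' integerPoints ℓ = castVec n '' Submodule.span ℤ (Set.range a) := by
  rw [← Fintype.range_linearCombination ℤ, LinearMap.coe_range, ← range_castVec,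
    ← Set.range_comp, ← Set.range_comp]
  exact congrArg Set.range (funext (latticeMap_castVec a))

theorem isLatticeParam_latticeMap {S : Set (Fin n → ℝ)} (hS : IsRational (Submodule.span ℝ S))
    (B : Module.Basis (Fin ℓ) ℤ (latticePoints (Submodule.span ℝ S))) :
    IsLatticeParam S (latticeMap fun k => (B k : Fin n → ℤ)) where
  dim_eq := by
    rw [← hS.finrank_latticePoints, Module.finrank_eq_card_basis B, Fintype.card_fin]
  subset_range := by
    rw [latticeMap, ← LinearMap.coe_range, Fintype.range_linearCombination,
      hS.span_range_castVec_basis B]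
    exact Submodule.subset_span
  map_lattice := by
    rw [image_latticeMap_integerPoints, span_range_coe_basis, image_castVec_latticePoints]

theorem IsLatticeParam.exists_eq_latticeMap {S : Set (Fin n → ℝ)}
    {L : (Fin ℓ → ℝ) →ₗ[ℝ] (Fin n → ℝ)} (hL : IsLatticeParam S L) :
    ∃ a : Fin ℓ → Fin n → ℤ, L = latticeMap a ∧
      Submodule.span ℤ (Set.range a) = latticePoints (Submodule.span ℝ S) := by
  have hint (k : Fin ℓ) : L (Pi.single k 1) ∈ Set.range (castVec n) := by
    rw [range_castVec]
    refine (hL.map_lattice.subset (Set.mem_image_of_mem L ?_)).2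
    rw [← range_castVec]
    exact ⟨Pi.single k 1, by ext j; simp [Pi.single_apply]⟩
  choose a ha using hint
  obtain rfl : L = latticeMap a :=
    LinearMap.pi_ext' fun k => LinearMap.ext_ring (by simp [ha])
  refine ⟨a, rfl, SetLike.coe_injective (castVec_injective.image_injective ?_)⟩
  rw [← image_latticeMap_integerPoints, hL.map_lattice, image_castVec_latticePoints]

theorem IsLatticeParam.comp {S : Set (Fin n → ℝ)} {L : (Fin ℓ → ℝ) →ₗ[ℝ] (Fin n → ℝ)}
    (hL : IsLatticeParam S L) {T : (Fin ℓ → ℝ) ≃ₗ[ℝ] (Fin ℓ → ℝ)}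
    (hT : T '' integerPoints ℓ = integerPoints ℓ) : IsLatticeParam S (L ∘ₗ T.toLinearMap) where
  dim_eq := hL.dim_eq
  subset_range := by
    rw [LinearMap.coe_comp, LinearEquiv.coe_coe, T.surjective.range_comp]
    exact hL.subset_range
  map_lattice := by
    rw [LinearMap.coe_comp, LinearEquiv.coe_coe, Set.image_comp, hT, hL.map_lattice]

theorem exists_basis_eq_pos_smul_coord {M : Type*} [AddCommGroup M] [Module.Free ℤ M]
    [Module.Finite ℤ M] {φ : M →ₗ[ℤ] ℤ} (hφ : φ ≠ 0) :
    ∃ (k : ℕ) (B : Module.Basis (Fin (k + 1)) ℤ M) (g : ℤ), 0 < g ∧ φ = g • B.coord 0 := by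
  obtain ⟨g₀, hg₀⟩ := IsPrincipalIdealRing.principal (LinearMap.range φ)
  obtain ⟨g, hg, hrange⟩ : ∃ g : ℤ, 0 ≤ g ∧ LinearMap.range φ = Ideal.span {g} :=
    ⟨g₀.natAbs, Int.natCast_nonneg _, hg₀.trans (Int.span_natAbs g₀).symm⟩
  have hdvd (x : M) : g ∣ φ x :=
    Ideal.mem_span_singleton.mp (hrange ▸ LinearMap.mem_range_self φ x)
  obtain ⟨v, hv⟩ : g ∈ LinearMap.range φ := hrange ▸ Ideal.mem_span_singleton_self g
  have hg0 : g ≠ 0 := by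
    rintro rfl
    exact hφ (LinearMap.ext fun x => zero_dvd_iff.mp (hdvd x))
  let e := Module.finBasis ℤ (LinearMap.ker φ)
  let B := Module.Basis.mkFinCons v e
    (fun c x hx h => by
      have hφh := congrArg φ h
      rw [map_add, map_smul, hv, LinearMap.mem_ker.mp hx, add_zero, map_zero] at hφh
      exact (smul_eq_zero.mp hφh).resolve_right hg0)
    (fun x => by
      obtain ⟨c, hc⟩ := hdvd x
      refine ⟨-c, ?_⟩
      rw [LinearMap.mem_ker, map_add, map_smul, hv, hc, smul_eq_mul]
      ring)
  have hB : ⇑B = Fin.cons v ((↑) ∘ e) := Module.Basis.coe_mkFinCons ..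
  refine ⟨_, B, g, lt_of_le_of_ne hg hg0.symm, B.ext (Fin.cases ?_ fun i => ?_)⟩
  · have hφB : φ (B 0) = g := by rw [hB, Fin.cons_zero, hv]
    simp [hφB]
  · have hφB : φ (B i.succ) = 0 := by
      rw [hB, Fin.cons_succ]
      exact (e i).2
    simp [hφB]

/-- The shear `e₀ ↦ e₀ - c (e₁ + ⋯ + e_k)` of `ℝ^(k+1)`, which makes `L ∘ shear k c` out of `L` the
parametrization with `L(e₀)` replaced by `L(e₀) - c (L(e₁) + ⋯ + L(e_k))`. -/
def shear (k : ℕ) (c : ℤ) : (Fin (k + 1) → ℝ) ≃ₗ[ℝ] (Fin (k + 1) → ℝ) :=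
  LinearEquiv.transvection (f := LinearMap.proj 0) (v := castVec (k + 1) (Fin.cons 0 fun _ => -c))
    (by simp)

theorem shear_apply {k : ℕ} (c : ℤ) (x : Fin (k + 1) → ℝ) :
    shear k c x = x + x 0 • castVec (k + 1) (Fin.cons 0 fun _ => -c) := rfl

theorem image_shear_integerPoints (k : ℕ) (c : ℤ) :
    shear k c '' integerPoints (k + 1) = integerPoints (k + 1) := by
  let integerShear : (Fin (k + 1) → ℤ) ≃ₗ[ℤ] (Fin (k + 1) → ℤ) :=
    LinearEquiv.transvection (f := LinearMap.proj 0) (v := Fin.cons 0 fun _ => -c) (by simp)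
  have hcomm : shear k c ∘ castVec (k + 1) = castVec (k + 1) ∘ integerShear := by
    funext a
    ext i
    simp [shear_apply, integerShear, LinearMap.transvection.apply]
  rw [← range_castVec, ← Set.range_comp, hcomm, integerShear.surjective.range_comp]

theorem norm_le_sum_of_mem_orthant {s : Fin n → ℝ} (hs : s ∈ orthant n) : ‖s‖ ≤ ∑ j, s j := by
  refine (pi_norm_le_iff_of_nonneg (Finset.sum_nonneg fun j _ => hs j)).mpr fun j => ?_
  rw [Real.norm_of_nonneg (hs j)]
  exact Finset.single_le_sum (fun i _ => hs i) (Finset.mem_univ j)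

theorem exists_shear_preimage_orthant_subset {k : ℕ} {L : (Fin (k + 1) → ℝ) →ₗ[ℝ] (Fin n → ℝ)}
    (hL : Function.Injective L) {g : ℝ} (hg : 0 < g) (hsum : ∀ x, ∑ j, L x j = g * x 0) :
    ∃ c : ℤ, (L ∘ₗ (shear k c).toLinearMap) ⁻¹' orthant n ⊆ orthant (k + 1) := by
  obtain ⟨C, -, hC⟩ := L.exists_antilipschitzWith (LinearMap.ker_eq_bot.mpr hL)
  obtain ⟨N, hN⟩ := exists_nat_ge (C * g)
  refine ⟨N, fun x hx => ?_⟩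
  set y := shear k N x
  have hy0 : y 0 = x 0 := by simp [y, shear_apply]
  have hyi (i : Fin k) : y i.succ = x i.succ - N * x 0 := by
    simp [y, shear_apply, sub_eq_add_neg, mul_comm]
  have hsub : ‖L y‖ ≤ g * x 0 :=
    calc ‖L y‖ ≤ ∑ j, L y j := norm_le_sum_of_mem_orthant hx
      _ = g * x 0 := by rw [hsum, hy0]
  have hx0 : 0 ≤ x 0 := nonneg_of_mul_nonneg_right ((norm_nonneg _).trans hsub) hg
  have hy : ‖y‖ ≤ N * x 0 :=
    calc ‖y‖ ≤ C * ‖L y‖ := by simpa using hC.le_mul_dist y 0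
      _ ≤ C * (g * x 0) := by gcongr
      _ = C * g * x 0 := by ring
      _ ≤ N * x 0 := by gcongr
  refine Fin.cases hx0 fun i => ?_
  have hlow := neg_le_of_abs_le ((norm_le_pi_norm y i.succ).trans hy)
  rw [hyi] at hlow
  linarith

theorem span_eq_bot_of_subset_orthant {S : Set (Fin n → ℝ)} (hpos : S ⊆ orthant n)
    (h : 1 ∈ orthogonalLattice S) : Submodule.span ℝ S = ⊥ := by
  refine Submodule.span_eq_bot.mpr fun s hs => norm_le_zero_iff.mp ?_
  calc ‖s‖ ≤ ∑ j, s j := norm_le_sum_of_mem_orthant (hpos hs)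
    _ = 0 := by simpa using h s hs

theorem exists_isLatticeParam_preimage_subset_orthant {S : Set (Fin n → ℝ)} (hpos : S ⊆ orthant n)
    (hS : IsRational (Submodule.span ℝ S)) :
    ∃ (ℓ : ℕ) (L : (Fin ℓ → ℝ) →ₗ[ℝ] (Fin n → ℝ)), IsLatticeParam S L ∧ L ⁻¹' S ⊆ orthant ℓ := by
  set Λ := latticePoints (Submodule.span ℝ S)
  let coordSum : Λ →ₗ[ℤ] ℤ := (dotProductEquiv ℤ (Fin n) 1).domRestrict Λ
  by_cases hφ : coordSum = 0
  · have h1 : 1 ∈ orthogonalLattice S := (mem_orthogonalLattice_iff hS).mpr fun a ha =>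
      LinearMap.congr_fun hφ ⟨a, ha⟩
    have hrank : Module.finrank ℤ Λ = 0 := by
      rw [hS.finrank_latticePoints, span_eq_bot_of_subset_orthant hpos h1, finrank_bot]
    exact ⟨0, _, isLatticeParam_latticeMap hS (Module.finBasisOfFinrankEq ℤ _ hrank),
      fun _ _ k => k.elim0⟩
  · obtain ⟨k, B, g, hg, hgB⟩ := exists_basis_eq_pos_smul_coord hφ
    have hsum (x : Fin (k + 1) → ℝ) :
        ∑ j, latticeMap (fun i => (B i : Fin n → ℤ)) x j = g * x 0 :=
      calc ∑ j, latticeMap (fun i => (B i : Fin n → ℤ)) x j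
          = ∑ i, x i * (coordSum (B i) : ℝ) := by
            simp only [latticeMap_apply, Finset.sum_apply, Pi.smul_apply, smul_eq_mul]
            rw [Finset.sum_comm]
            simp [← Finset.mul_sum, coordSum, one_dotProduct]
        _ = g * x 0 := by simp [hgB, Finsupp.single_apply, mul_comm]
    obtain ⟨c, hc⟩ := exists_shear_preimage_orthant_subset
      (linearIndependent_castVec_basis B).fintypeLinearCombination_injective
      (Int.cast_pos.mpr hg) hsum
    exact ⟨k + 1, _, (isLatticeParam_latticeMap hS B).comp (image_shear_integerPoints k c),
      (Set.preimage_mono hpos).trans hc⟩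

/-! ### Characters and fibers -/

/-- The character `a ↦ z^a` of `ℤⁿ` attached to a point `z` of the torus. -/
def character (z : Fin n → ℂˣ) : (Fin n → ℤ) →ₗ[ℤ] Additive ℂˣ :=
  Fintype.linearCombination ℤ fun j => Additive.ofMul (z j)

theorem laurentMonomial_coe (z : Fin n → ℂˣ) (a : Fin n → ℤ) :
    laurentMonomial (fun j => (z j : ℂ)) a = ((character z a).toMul : ℂˣ) := by
  simp [laurentMonomial, character, Fintype.linearCombination_apply]

theorem laurentMonomial_coe_eq_iff {w z : Fin n → ℂˣ} {a : Fin n → ℤ} :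
    laurentMonomial (fun j => (w j : ℂ)) a = laurentMonomial (fun j => (z j : ℂ)) a ↔
      character w a = character z a := by
  rw [laurentMonomial_coe, laurentMonomial_coe, Units.val_inj, Additive.toMul.apply_eq_iff_eq]

@[simp]
theorem character_single (z : Fin n → ℂˣ) (j : Fin n) :
    character z (Pi.single j 1) = Additive.ofMul (z j) := by
  simp [character, Fintype.linearCombination_apply_single]

theorem character_surjective : Function.Surjective (character (n := n)) := fun χ =>
  ⟨fun j => (χ (Pi.single j 1)).toMul,
    LinearMap.pi_ext' fun j => LinearMap.ext_ring (by simp)⟩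

theorem baer_additive_units {k : Type*} [Field k] [IsAlgClosed k] :
    Module.Baer ℤ (Additive kˣ) := by
  have hroot {m : ℕ} (hm : m ≠ 0) : Function.Surjective (m • · : Additive kˣ → Additive kˣ) := by
    intro x
    obtain ⟨y, hy⟩ := IsAlgClosed.exists_pow_nat_eq (x.toMul : k) (Nat.pos_of_ne_zero hm)
    have hy0 : y ≠ 0 := by
      rintro rfl
      exact x.toMul.ne_zero (by rw [← hy, zero_pow hm])
    exact ⟨Additive.ofMul (Units.mk0 y hy0), Additive.toMul.injective (Units.ext hy)⟩
  let : DivisibleBy (Additive kˣ) ℕ := divisibleByOfSMulRightSurj _ _ fun hm => hroot hm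
  let : DivisibleBy (Additive kˣ) ℤ := AddGroup.divisibleByIntOfDivisibleByNat _
  exact Module.Baer.of_divisible _

theorem exists_comp_eq_iff_ker_le {R A M N : Type*} [CommRing R] [AddCommGroup A] [Module R A]
    [AddCommGroup M] [Module R M] [AddCommGroup N] [Module R N] (hA : Module.Baer R A)
    (f : M →ₗ[R] N) (χ : M →ₗ[R] A) :
    (∃ τ : N →ₗ[R] A, τ ∘ₗ f = χ) ↔ LinearMap.ker f ≤ LinearMap.ker χ := by
  constructor
  · rintro ⟨τ, rfl⟩
    exact LinearMap.ker_le_ker_comp f τ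
  · intro h
    obtain ⟨τ, hτ⟩ := hA.extension_property ((LinearMap.ker f).liftQ f le_rfl)
      (LinearMap.ker_eq_bot.mp (Submodule.ker_liftQ_eq_bot' _ _ rfl)) ((LinearMap.ker f).liftQ χ h)
    refine ⟨τ, ?_⟩
    simpa [LinearMap.comp_assoc] using congrArg (· ∘ₗ (LinearMap.ker f).mkQ) hτ

theorem laurentMonomial_ne_zero {z : Fin n → ℂ} (hz : z ∈ torus n) (a : Fin n → ℤ) :
    laurentMonomial z a ≠ 0 :=
  Finset.prod_ne_zero_iff.mpr fun j _ => zpow_ne_zero _ (hz j)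

theorem laurentMonomial_add {z : Fin n → ℂ} (hz : z ∈ torus n) (a b : Fin n → ℤ) :
    laurentMonomial z (a + b) = laurentMonomial z a * laurentMonomial z b := by
  simp only [laurentMonomial, Pi.add_apply, ← Finset.prod_mul_distrib]
  exact Finset.prod_congr rfl fun j _ => zpow_add₀ (hz j) _ _

theorem monomialMap_latticeMap (a : Fin ℓ → Fin n → ℤ) (z : Fin n → ℂ) (k : Fin ℓ) :
    monomialMap (latticeMap a) z k = laurentMonomial z (a k) := by
  simp [monomialMap]

theorem mem_monomialFiber_iff {S : Set (Fin n → ℝ)} {L : (Fin ℓ → ℝ) →ₗ[ℝ] (Fin n → ℝ)}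
    (hL : IsLatticeParam S L) {z w : Fin n → ℂ} (hz : z ∈ torus n) (hw : w ∈ torus n) :
    w ∈ monomialFiber L z ↔
      ∀ a ∈ latticePoints (Submodule.span ℝ S), laurentMonomial w a = laurentMonomial z a := by
  obtain ⟨a, rfl, hspan⟩ := hL.exists_eq_latticeMap
  lift z to Fin n → ℂˣ using fun j => (hz j).isUnit
  lift w to Fin n → ℂˣ using fun j => (hw j).isUnit
  simp only [monomialFiber, Set.mem_ofPred_eq, hw, true_and, funext_iff, monomialMap_latticeMap,
    laurentMonomial_coe_eq_iff, ← hspan]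
  exact Set.forall_mem_range.symm.trans
    (Submodule.span_le (p := LinearMap.eqLocus (character w) (character z))).symm

theorem fiberParam_mem_torus {d : ℕ} (b : Fin d → Fin n → ℤ) {z : Fin n → ℂ} (hz : z ∈ torus n)
    {t : Fin d → ℂ} (ht : t ∈ torus d) : fiberParam b z t ∈ torus n :=
  fun j => mul_ne_zero (hz j) (laurentMonomial_ne_zero ht _)

theorem fiberParam_coe_eq_iff {d : ℕ} {b : Fin d → Fin n → ℤ} {z w : Fin n → ℂˣ}
    {t : Fin d → ℂˣ} :
    (fiberParam b (fun j => (z j : ℂ)) fun k => (t k : ℂ)) = (fun j => (w j : ℂ)) ↔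
      character t ∘ₗ Matrix.mulVecLin (Matrix.of b) = character w - character z := by
  have hcol (j : Fin n) : Matrix.mulVecLin (Matrix.of b) (Pi.single j 1) = fun k => b k j := by
    ext k
    simp
  have hcoord (j : Fin n) : fiberParam b (fun j => (z j : ℂ)) (fun k => (t k : ℂ)) j = w j ↔
      (character t ∘ₗ Matrix.mulVecLin (Matrix.of b)) (Pi.single j 1) =
        (character w - character z) (Pi.single j 1) := by
    rw [eq_comm, fiberParam, laurentMonomial_coe, ← Units.val_mul, Units.val_inj,
      LinearMap.comp_apply, hcol, LinearMap.sub_apply, character_single, character_single,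
      eq_sub_iff_add_eq', eq_comm]
    rfl
  rw [funext_iff, forall_congr' hcoord]
  exact ⟨fun h => LinearMap.pi_ext' fun j => LinearMap.ext_ring (h j), fun h j => by rw [h]⟩

theorem mem_image_fiberParam_iff {S : Set (Fin n → ℝ)} (hS : IsRational (Submodule.span ℝ S))
    {d : ℕ} {b : Fin d → Fin n → ℤ} (hb : Submodule.span ℤ (Set.range b) = orthogonalLattice S)
    {z w : Fin n → ℂ} (hz : z ∈ torus n) (hw : w ∈ torus n) :
    w ∈ fiberParam b z '' torus d ↔
      ∀ a ∈ latticePoints (Submodule.span ℝ S), laurentMonomial w a = laurentMonomial z a := by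
  lift z to Fin n → ℂˣ using fun j => (hz j).isUnit
  lift w to Fin n → ℂˣ using fun j => (hw j).isUnit
  calc (fun j => (w j : ℂ)) ∈ fiberParam b (fun j => (z j : ℂ)) '' torus d
      ↔ ∃ t : Fin d → ℂˣ,
          (fiberParam b (fun j => (z j : ℂ)) fun k => (t k : ℂ)) = fun j => (w j : ℂ) := by
        constructor
        · rintro ⟨t, ht, htw⟩
          lift t to Fin d → ℂˣ using fun k => (ht k).isUnit
          exact ⟨t, htw⟩
        · rintro ⟨t, htw⟩
          exact ⟨_, fun k => (t k).ne_zero, htw⟩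
    _ ↔ ∃ τ, τ ∘ₗ Matrix.mulVecLin (Matrix.of b) = character w - character z := by
        simp only [fiberParam_coe_eq_iff, character_surjective.exists]
    _ ↔ ∀ a ∈ latticePoints (Submodule.span ℝ S), (character w - character z) a = 0 := by
        rw [exists_comp_eq_iff_ker_le baer_additive_units,
          ker_mulVecLin_of_span_eq_orthogonalLattice hS hb]
        rfl
    _ ↔ _ := by simp only [LinearMap.sub_apply, sub_eq_zero, laurentMonomial_coe_eq_iff]

/-! ### Hulls -/

theorem laurentMonomial_natCast (z : Fin n → ℂ) (α : Fin n → ℕ) :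
    laurentMonomial z (fun j => (α j : ℤ)) = ∏ j, z j ^ α j := by
  simp [laurentMonomial]

theorem supNorm_singleton (z : Fin n → ℂ) (p : MvPolynomial (Fin n) ℂ) :
    supNorm {z} p = ‖MvPolynomial.eval z p‖ₑ := by
  simp [supNorm]

theorem hull_mono (S : Set (Fin n → ℝ)) : Monotone (hull S) := fun _ _ hKL _ hz p hp =>
  (hz p hp).trans (biSup_mono hKL)

theorem monomial_sub_const_mem_polyRing {S : Set (Fin n → ℝ)} (h0 : 0 ∈ S) {m : ℕ} {α : Fin n →₀ ℕ}
    (hα : (fun j => (α j : ℝ)) ∈ (m : ℝ) • S) (c : ℂ) :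
    MvPolynomial.monomial α 1 - MvPolynomial.C c ∈ polyRing S := by
  classical
  refine Set.mem_iUnion.mpr ⟨m, fun β hβ => ?_⟩
  rcases Finset.mem_union.mp (MvPolynomial.support_sub _ _ _ hβ) with h | h
  · rwa [Finset.mem_singleton.mp (MvPolynomial.support_monomial_subset h)]
  · rw [Finset.mem_singleton.mp (MvPolynomial.support_monomial_subset h)]
    exact ⟨0, h0, by ext; simp⟩

theorem mem_hull_singleton_iff {S : Set (Fin n → ℝ)} (h0 : 0 ∈ S) {z w : Fin n → ℂ} :
    w ∈ hull S {z} ↔ ∀ (m : ℕ) (α : Fin n →₀ ℕ), (fun j => (α j : ℝ)) ∈ (m : ℝ) • S →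
      ∏ j, w j ^ α j = ∏ j, z j ^ α j := by
  constructor
  · intro hw m α hα
    have h := hw _ (monomial_sub_const_mem_polyRing h0 hα (∏ j, z j ^ α j))
    simpa [supNorm_singleton, MvPolynomial.eval_monomial, Finsupp.prod_fintype, sub_eq_zero] using h
  · intro h p hp
    obtain ⟨m, hm⟩ := Set.mem_iUnion.mp hp
    have heval : MvPolynomial.eval w p = MvPolynomial.eval z p := by
      rw [MvPolynomial.eval_eq', MvPolynomial.eval_eq']
      exact Finset.sum_congr rfl fun α hα => by rw [h m α (hm α hα)]
    rw [supNorm_singleton, heval]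

theorem exists_nat_mem_smul_of_mem_coneHull {E : Type*} [AddCommGroup E] [Module ℝ E] {S : Set E}
    (hconv : Convex ℝ S) (h0 : 0 ∈ S) {x : E} (hx : x ∈ PointedCone.hull ℝ S) :
    ∃ m : ℕ, x ∈ (m : ℝ) • S := by
  induction hx using Submodule.closure_induction with
  | zero => exact ⟨0, 0, h0, smul_zero _⟩
  | add x y _ _ hx hy =>
    obtain ⟨k, hx⟩ := hx
    obtain ⟨m, hy⟩ := hy
    refine ⟨k + m, ?_⟩
    rw [Nat.cast_add, hconv.add_smul k.cast_nonneg m.cast_nonneg]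
    exact Set.add_mem_add hx hy
  | smul_mem r x hx =>
    obtain ⟨N, hN⟩ := exists_nat_gt (r : ℝ)
    have hN0 : (0 : ℝ) < N := r.2.trans_lt hN
    refine ⟨N, (r / N : ℝ) • x, hconv.smul_mem_of_zero_mem h0 hx
      ⟨div_nonneg r.2 hN0.le, (div_le_one hN0).mpr hN.le⟩, ?_⟩
    exact (smul_smul ..).trans (by rw [mul_div_cancel₀ _ hN0.ne']; rfl)

theorem exists_castVec_add_mem_coneHull {T : Set (Fin n → ℝ)} (hT : T ⊆ rationalPoints n)
    {x : Fin n → ℝ} (hx : x ∈ Submodule.span ℝ T) :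
    ∃ c, castVec n c ∈ PointedCone.hull ℝ T ∧ x + castVec n c ∈ PointedCone.hull ℝ T := by
  induction hx using Submodule.closure_induction with
  | zero => exact ⟨0, by simp⟩
  | add x y _ _ hx hy =>
    obtain ⟨c, hc, hxc⟩ := hx
    obtain ⟨e, he, hye⟩ := hy
    refine ⟨c + e, ?_, ?_⟩
    · rw [map_add]
      exact add_mem hc he
    · rw [map_add, add_add_add_comm]
      exact add_mem hxc hye
  | smul_mem r x hx =>
    obtain ⟨D, hD, e, hDx⟩ := exists_nat_smul_eq_castVec (hT hx)
    obtain ⟨N, hN⟩ := exists_nat_ge |r|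
    have hcone {c : ℝ} (hc : 0 ≤ c) : c • x ∈ PointedCone.hull ℝ T :=
      (PointedCone.hull ℝ T).smul_mem hc (PointedCone.subset_hull hx)
    have hNe : castVec n (N • e) = (N * D : ℝ) • x := by
      rw [map_nsmul, ← hDx, mul_smul, Nat.cast_smul_eq_nsmul ℝ N]
    have hND : (N : ℝ) ≤ N * D := le_mul_of_one_le_right N.cast_nonneg (mod_cast hD)
    refine ⟨N • e, hNe ▸ hcone (by positivity), ?_⟩
    rw [hNe, ← add_smul]
    exact hcone (by linarith [neg_abs_le r])

theorem exists_nat_cast_eq_of_castVec_mem_orthant {a : Fin n → ℤ} (ha : castVec n a ∈ orthant n) :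
    ∃ α : Fin n →₀ ℕ, a = fun j => (α j : ℤ) :=
  ⟨Finsupp.equivFunOnFinite.symm fun j => (a j).toNat, funext fun j =>
    (Int.toNat_of_nonneg (Int.cast_nonneg_iff.mp (ha j))).symm⟩

theorem laurentMonomial_eq_of_mem_hull {S : Set (Fin n → ℝ)} (hpos : S ⊆ orthant n)
    (h0 : 0 ∈ S) {z w : Fin n → ℂ} (hw : w ∈ hull S {z}) {a : Fin n → ℤ} {m : ℕ}
    (ha : castVec n a ∈ (m : ℝ) • S) : laurentMonomial w a = laurentMonomial z a := by
  have ha' : castVec n a ∈ orthant n := by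
    obtain ⟨s, hs, hsa⟩ := ha
    exact hsa ▸ fun j => mul_nonneg m.cast_nonneg (hpos hs j)
  obtain ⟨α, rfl⟩ := exists_nat_cast_eq_of_castVec_mem_orthant ha'
  rw [laurentMonomial_natCast, laurentMonomial_natCast]
  exact (mem_hull_singleton_iff h0).mp hw m α ha

theorem mem_hull_singleton_of_forall_mem_span {S : Set (Fin n → ℝ)} (h0 : 0 ∈ S) {z w : Fin n → ℂ}
    (h : ∀ α : Fin n → ℕ, (fun j => (α j : ℝ)) ∈ Submodule.span ℝ S →
      ∏ j, w j ^ α j = ∏ j, z j ^ α j) : w ∈ hull S {z} := by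
  refine (mem_hull_singleton_iff h0).mpr fun m α hα => h α ?_
  obtain ⟨s, hs, hsα⟩ := hα
  exact hsα ▸ Submodule.smul_mem _ _ (Submodule.subset_span hs)

theorem mem_hull_singleton_iff_of_mem_torus {S : Set (Fin n → ℝ)} (hconv : Convex ℝ S)
    (hpos : S ⊆ orthant n) (h0 : 0 ∈ S)
    (hS : Submodule.span ℝ (S ∩ rationalPoints n) = Submodule.span ℝ S)
    {z w : Fin n → ℂ} (hz : z ∈ torus n) (hw : w ∈ torus n) :
    w ∈ hull S {z} ↔
      ∀ a ∈ latticePoints (Submodule.span ℝ S), laurentMonomial w a = laurentMonomial z a := by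
  constructor
  · intro hwz a ha
    have hcone {e : Fin n → ℤ} (he : castVec n e ∈ PointedCone.hull ℝ (S ∩ rationalPoints n)) :
        laurentMonomial w e = laurentMonomial z e := by
      obtain ⟨m, hm⟩ := exists_nat_mem_smul_of_mem_coneHull hconv h0
        (Submodule.span_mono Set.inter_subset_left he)
      exact laurentMonomial_eq_of_mem_hull hpos h0 hwz hm
    rw [mem_latticePoints, ← hS] at ha
    obtain ⟨c, hc, hac⟩ := exists_castVec_add_mem_coneHull Set.inter_subset_right ha
    rw [← map_add] at hac
    refine mul_right_cancel₀ (laurentMonomial_ne_zero hz c) ?_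
    calc laurentMonomial w a * laurentMonomial z c
        = laurentMonomial w (a + c) := by rw [laurentMonomial_add hw, hcone hc]
      _ = laurentMonomial z (a + c) := hcone hac
      _ = laurentMonomial z a * laurentMonomial z c := laurentMonomial_add hz a c
  · intro h
    refine mem_hull_singleton_of_forall_mem_span h0 fun α hα => ?_
    rw [← laurentMonomial_natCast, ← laurentMonomial_natCast]
    exact h _ hα

theorem exists_orthogonal_ne_zero {V : Submodule ℝ (Fin n → ℝ)} (hV : V ≠ ⊤) :
    ∃ ξ : Fin n → ℝ, ξ ≠ 0 ∧ ∀ x ∈ V, ξ ⬝ᵥ x = 0 := by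
  obtain ⟨f, hf, hfV⟩ := V.exists_le_ker_of_lt_top hV.lt_top
  obtain ⟨ξ, rfl⟩ := (dotProductEquiv ℝ (Fin n)).surjective f
  exact ⟨ξ, by simpa using hf, hfV⟩

theorem exp_curve_mem_hull_singleton {S : Set (Fin n → ℝ)} (h0 : 0 ∈ S) {ξ : Fin n → ℝ}
    (hξ : ∀ x ∈ Submodule.span ℝ S, ξ ⬝ᵥ x = 0) (z : Fin n → ℂ) (τ : ℝ) :
    (fun j => z j * Real.exp (τ * ξ j)) ∈ hull S {z} := by
  refine mem_hull_singleton_of_forall_mem_span h0 fun α hα => ?_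
  have hexp : ∏ j, Real.exp (τ * ξ j) ^ α j = 1 :=
    calc ∏ j, Real.exp (τ * ξ j) ^ α j
        = Real.exp (τ * (ξ ⬝ᵥ fun j => (α j : ℝ))) := by
          simp only [← Real.exp_nat_mul, ← Real.exp_sum, dotProduct, Finset.mul_sum]
          exact congrArg Real.exp (Finset.sum_congr rfl fun j _ => by ring)
      _ = 1 := by rw [hξ _ hα, mul_zero, Real.exp_zero]
  simp only [mul_pow, Finset.prod_mul_distrib]
  rw [show ∏ j, (Real.exp (τ * ξ j) : ℂ) ^ α j = 1 by exact_mod_cast hexp, mul_one]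

theorem not_isBounded_hull {S : Set (Fin n → ℝ)} (h0 : 0 ∈ S) (hspan : Submodule.span ℝ S ≠ ⊤)
    {K : Set (Fin n → ℂ)} (hK : (K ∩ torus n).Nonempty) : ¬ Bornology.IsBounded (hull S K) := by
  obtain ⟨z, hzK, hz⟩ := hK
  obtain ⟨ξ, hξ0, hξ⟩ := exists_orthogonal_ne_zero hspan
  obtain ⟨j, hj⟩ := Function.ne_iff.mp hξ0
  intro hb
  obtain ⟨C, hC⟩ := hb.exists_norm_le
  have hzj : 0 < ‖z j‖ := norm_pos_iff.mpr (hz j)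
  have hbound (s : ℝ) : ‖z j‖ * Real.exp s ≤ C := by
    have hmem := hull_mono S (Set.singleton_subset_iff.mpr hzK)
      (exp_curve_mem_hull_singleton h0 hξ z (s / ξ j))
    simpa [div_mul_cancel₀ _ hj] using (norm_le_pi_norm _ j).trans (hC _ hmem)
  obtain ⟨s, hs⟩ := ((Real.tendsto_exp_atTop.const_mul_atTop hzj).eventually_gt_atTop C).exists
  exact hs.not_ge (hbound s)

theorem span_ne_top_of_interior_eq_empty {E : Type*} [NormedAddCommGroup E] [NormedSpace ℝ E]
    [FiniteDimensional ℝ E] {S : Set E} (hconv : Convex ℝ S) (h0 : 0 ∈ S)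
    (hint : interior S = ∅) : Submodule.span ℝ S ≠ ⊤ := by
  intro hspan
  have haff : affineSpan ℝ S = ⊤ := by
    apply SetLike.coe_injective
    rw [← Set.insert_eq_of_mem h0, affineSpan_insert_zero, hspan, Submodule.top_coe,
      AffineSubspace.top_coe]
  exact (hconv.interior_nonempty_iff_affineSpan_eq_top.mpr haff).ne_empty hint

theorem hull_inter_torus_eq_monomialFiber {S : Set (Fin n → ℝ)} (hconv : Convex ℝ S)
    (hpos : S ⊆ orthant n) (h0 : 0 ∈ S)
    (hS : Submodule.span ℝ (S ∩ rationalPoints n) = Submodule.span ℝ S)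
    {L : (Fin ℓ → ℝ) →ₗ[ℝ] (Fin n → ℝ)} (hL : IsLatticeParam S L) {z : Fin n → ℂ}
    (hz : z ∈ torus n) : hull S {z} ∩ torus n = monomialFiber L z :=
  Set.ext fun _ =>
    ⟨fun ⟨hwz, hw⟩ => (mem_monomialFiber_iff hL hz hw).mpr <|
      (mem_hull_singleton_iff_of_mem_torus hconv hpos h0 hS hz hw).mp hwz,
    fun hwz => ⟨(mem_hull_singleton_iff_of_mem_torus hconv hpos h0 hS hz hwz.1).mpr <|
      (mem_monomialFiber_iff hL hz hwz.1).mp hwz, hwz.1⟩⟩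

theorem monomialFiber_eq_image_fiberParam {S : Set (Fin n → ℝ)}
    (hS : IsRational (Submodule.span ℝ S)) {L : (Fin ℓ → ℝ) →ₗ[ℝ] (Fin n → ℝ)}
    (hL : IsLatticeParam S L) {d : ℕ} {b : Fin d → Fin n → ℤ}
    (hb : Submodule.span ℤ (Set.range b) = orthogonalLattice S) {z : Fin n → ℂ}
    (hz : z ∈ torus n) : monomialFiber L z = fiberParam b z '' torus d :=
  Set.Subset.antisymm
    (fun _ hwz => (mem_image_fiberParam_iff hS hb hz hwz.1).mpr <|
      (mem_monomialFiber_iff hL hz hwz.1).mp hwz)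
    (Set.image_subset_iff.mpr fun _ ht => (mem_monomialFiber_iff hL hz
      (fiberParam_mem_torus b hz ht)).mpr <| (mem_image_fiberParam_iff hS hb hz
        (fiberParam_mem_torus b hz ht)).mp (Set.mem_image_of_mem _ ht))

end SHull

theorem proposition2p5_general {n : ℕ} (S : Set (Fin n → ℝ)) (hS_convex : Convex ℝ S)
    (hS_orthant : S ⊆ SHull.orthant n) (hS_zero : (0 : Fin n → ℝ) ∈ S) :
    (Submodule.span ℝ (S ∩ SHull.rationalPoints n) = Submodule.span ℝ S →
      ∃ ℓ : ℕ, ℓ = Module.finrank ℝ (Submodule.span ℝ S) ∧ (interior S = ∅ → ℓ < n) ∧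
        (∃ L : (Fin ℓ → ℝ) →ₗ[ℝ] (Fin n → ℝ),
          SHull.IsLatticeParam S L ∧ L ⁻¹' S ⊆ SHull.orthant ℓ) ∧
        (∃ b : Fin (n - ℓ) → Fin n → ℤ,
          Submodule.span ℤ (Set.range b) = SHull.orthogonalLattice S) ∧
        ∀ L : (Fin ℓ → ℝ) →ₗ[ℝ] (Fin n → ℝ), SHull.IsLatticeParam S L →
        ∀ b : Fin (n - ℓ) → Fin n → ℤ,
          Submodule.span ℤ (Set.range b) = SHull.orthogonalLattice S →
        ∀ z ∈ SHull.torus n,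
          SHull.hull S {z} ∩ SHull.torus n = SHull.monomialFiber L z ∧
          SHull.monomialFiber L z = SHull.fiberParam b z '' SHull.torus (n - ℓ)) ∧
    (interior S = ∅ → ∀ K : Set (Fin n → ℂ), (K ∩ SHull.torus n).Nonempty →
      ¬ Bornology.IsBounded (SHull.hull S K)) := by
  have hproper (hint : interior S = ∅) : Submodule.span ℝ S ≠ ⊤ :=
    SHull.span_ne_top_of_interior_eq_empty hS_convex hS_zero hint
  refine ⟨fun hspan => ?_, fun hint K hK => SHull.not_isBounded_hull hS_zero (hproper hint) hK⟩
  have hS : SHull.IsRational (Submodule.span ℝ S) :=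
    hspan ▸ SHull.isRational_span Set.inter_subset_right
  obtain ⟨ℓ, L, hL, hLS⟩ := SHull.exists_isLatticeParam_preimage_subset_orthant hS_orthant hS
  obtain rfl := hL.dim_eq
  refine ⟨_, rfl, fun hint => by simpa using Submodule.finrank_lt (hproper hint), ⟨L, hL, hLS⟩,
    SHull.exists_span_range_eq_orthogonalLattice hS, fun L hL b hb z hz => ⟨?_, ?_⟩⟩
  · exact SHull.hull_inter_torus_eq_monomialFiber hS_convex hS_orthant hS_zero hspan hL hz
  · exact SHull.monomialFiber_eq_image_fiberParam hS hL hb hz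

theorem proposition2p5 {n : ℕ} (S : Set (Fin n → ℝ))
    (hS_compact : IsCompact S) (hS_convex : Convex ℝ S)
    (hS_orthant : S ⊆ SHull.orthant n) (hS_zero : (0 : Fin n → ℝ) ∈ S)
    (hS_interior : interior S = ∅) :
    (closure (S ∩ SHull.rationalPoints n) = S →
      ∃ ℓ : ℕ, ℓ = Module.finrank ℝ (Submodule.span ℝ S) ∧ ℓ < n ∧
        (∃ L : (Fin ℓ → ℝ) →ₗ[ℝ] (Fin n → ℝ),
          SHull.IsLatticeParam S L ∧ L ⁻¹' S ⊆ SHull.orthant ℓ) ∧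
        (∃ b : Fin (n - ℓ) → Fin n → ℤ,
          Submodule.span ℤ (Set.range b) = SHull.orthogonalLattice S) ∧
        ∀ L : (Fin ℓ → ℝ) →ₗ[ℝ] (Fin n → ℝ), SHull.IsLatticeParam S L →
        ∀ b : Fin (n - ℓ) → Fin n → ℤ,
          Submodule.span ℤ (Set.range b) = SHull.orthogonalLattice S →
        ∀ z ∈ SHull.torus n,
          SHull.hull S {z} ∩ SHull.torus n = SHull.monomialFiber L z ∧
          SHull.monomialFiber L z = SHull.fiberParam b z '' SHull.torus (n - ℓ)) ∧
    ∀ K : Set (Fin n → ℂ), (K ∩ SHull.torus n).Nonempty →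
      ¬ Bornology.IsBounded (SHull.hull S K) := by
  obtain ⟨hpart₁, hpart₂⟩ := proposition2p5_general S hS_convex hS_orthant hS_zero
  refine ⟨fun hQ => ?_, hpart₂ hS_interior⟩
  obtain ⟨ℓ, hℓ, hlt, h⟩ := hpart₁ (SHull.span_eq_of_subset_closure Set.inter_subset_left hQ.ge)
  exact ⟨ℓ, hℓ, hlt hS_interior, h⟩
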